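/- **Setting.** Let $X$ be a set and $\mathbf H=\{\mathcal H_x\}_{x\in X}$ a family of (complex) Krein spaces. A Krein space is a complex vector space with an indefinite inner product $[\cdot,\cdot]$ that is the orthogonal direct sum of subspaces $\mathcal K_+$ and $\mathcal K_-$ which are Hilbert spaces for $[\cdot,\cdot]$ and $-[\cdot,\cdot]$ respectively; it carries the Hilbert space topology of any such decomposition. An $\mathbf H$-kernel is a map $K$ on $X\times X$ with $K(x,y)\colon\mathcal H_y\to\mathcal H_x$ a bounded linear operator. On the space $\mathcal F_0$ of finitely supported vector fields $f=(f(x))_{x\in X}$, $f(x)\in\mathcal H_x$, put $$[f,g]_K=\sum_{x,y\in X}[K(x,y)f(y),g(x)]_{\mathcal H_x}.$$ The kernel $K$ is *positive semidefinite* if $[f,f]_K\ge 0$ for all $f\in\mathcal F_0$, and $H\le K$ means $[f,f]_H\le[f,f]_K$ for all $f\in\mathcal F_0$. Positive semidefinite kernels $H,K$ are *independent* if the only positive semidefinite $\mathbf H$-kernel $P$ with $P\le H$ and $P\le K$ is $P=0$. The *rank* of $K$ is the dimension of the range of its convolution operator $f\mapsto\big(\sum_{y}K(x,y)f(y)\big)_{x\in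 X}$ on $\mathcal F_0$. For $K$ positive semidefinite, $\mathcal K_K$ denotes the Hilbert space obtained from $(\mathcal F_0,[\cdot,\cdot]_K)$ by quotient completion. For $H,K$ positive semidefinite, $H$ is *$K$-compact* if $H\le K$ and the canonical contraction $\mathcal K_K\to\mathcal K_H$ induced by the identity of $\mathcal F_0$ is a compact operator. A *linearisation* of an $\mathbf H$-kernel $H$ is a pair $(\mathcal K;V)$ of a Krein space $\mathcal K$ and bounded operators $V(x)\colon\mathcal H_x\to\mathcal K$ ($x\in X$) with $H(x,y)=V(x)^\sharp V(y)$ for all $x,y\in X$, where $^\sharp$ is the Krein space adjoint. It is *minimal* if $\mathcal K$ is the closed linear span of the subspaces $V(x)\mathcal H_x$, $x\in X$. Linearisations $(\mathcal K_1;V_1)$ and $(\mathcal K_2;V_2)$ of $H$ are *unitary equivalent* if there is a bounded bijective linear operator $U\colon\mathcal K_1\to\mathcal K_2$ with bounded inverse, preserving the indefinite inner products, such that $V_2(x)=UV_1(x)$ for all $x\in X$. **Statement.** Let $H_+$ and $H_-$ be two independent positive semidefinite $\mathbf H$-kernels, both of infinite rank. If there is a positive semidefinite $\mathbf H$-kernel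 $K$ such that $H_+$ and $H_-$ are both $K$-compact, then the minimal linearisations of $H_+-H_-$ are not unique up to unitary equivalence: there exist two minimal linearisations of $H_+-H_-$ that are not unitary equivalent. -/

import Mathlib

universe u v w w'

/-! ### Krein spaces and their bounded operators -/

/-- A Krein space, presented as a complex Hilbert space `E` together with a fundamental symmetry
`J = P₊ - P₋` (selfadjoint and unitary, i.e. `J* = J` and `J² = 1`). The Hilbert space structure is
the positive definite inner product `⟨x, y⟩ = [J x, y]` of a fundamental decomposition
`E = E₊ [+] E₋`, where `E₊ = ker (J - 1)` and `E₋ = ker (J + 1)`; it provides the norm and the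
strong topology. The indefinite inner product is `kreinInner`. -/
class KreinSpace (E : Type u) [NormedAddCommGroup E] [InnerProductSpace ℂ E] [CompleteSpace E] where
  /-- The fundamental symmetry. -/
  J : E →L[ℂ] E
  adjoint_J : ContinuousLinearMap.adjoint J = J
  J_comp_J : J ∘L J = ContinuousLinearMap.id ℂ E

section Krein

variable {E : Type u} [NormedAddCommGroup E] [InnerProductSpace ℂ E] [CompleteSpace E]
  [KreinSpace E]
variable {F : Type v} [NormedAddCommGroup F] [InnerProductSpace ℂ F] [CompleteSpace F]
  [KreinSpace F]

/-- The indefinite inner product `[x, y] = ⟨J x, y⟩`, linear in `x` and conjugate linear in `y`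
(Mathlib's `inner` is linear in its second argument). -/
noncomputable def kreinInner (x y : E) : ℂ := inner ℂ y (KreinSpace.J x)

/-- The Krein space adjoint `T♯ = J_E T* J_F` of a bounded operator `T : E → F`. -/
noncomputable def kreinAdjoint (T : E →L[ℂ] F) : F →L[ℂ] E :=
  (KreinSpace.J : E →L[ℂ] E) ∘L ContinuousLinearMap.adjoint T ∘L (KreinSpace.J : F →L[ℂ] F)

theorem inner_J_left (x y : E) :
    inner ℂ (KreinSpace.J x) y = inner ℂ x (KreinSpace.J y) := by
  conv_lhs => rw [← KreinSpace.adjoint_J (E := E)]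
  exact ContinuousLinearMap.adjoint_inner_left _ _ _

/-- The defining property of the adjoint: `[T x, y] = [x, T♯ y]`. -/
theorem kreinInner_kreinAdjoint (T : E →L[ℂ] F) (x : E) (y : F) :
    kreinInner (T x) y = kreinInner x (kreinAdjoint T y) := by
  have hJ (z : E) : KreinSpace.J (KreinSpace.J z) = z :=
    congrArg (fun S : E →L[ℂ] E => S z) KreinSpace.J_comp_J
  simp only [kreinInner, kreinAdjoint, ContinuousLinearMap.comp_apply]
  rw [← inner_J_left, ← inner_J_left, hJ, ContinuousLinearMap.adjoint_inner_left]

theorem kreinInner_add_left (x y z : E) :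
    kreinInner (x + y) z = kreinInner x z + kreinInner y z := by
  simp [kreinInner]

theorem kreinInner_add_right (x y z : E) :
    kreinInner x (y + z) = kreinInner x y + kreinInner x z := by
  simp [kreinInner]

theorem kreinInner_smul_left (c : ℂ) (x y : E) :
    kreinInner (c • x) y = c * kreinInner x y := by
  simp [kreinInner]

theorem kreinInner_smul_right (c : ℂ) (x y : E) :
    kreinInner x (c • y) = (starRingEnd ℂ) c * kreinInner x y := by
  simp [kreinInner, mul_comm]

theorem kreinInner_zero_left (y : E) : kreinInner 0 y = 0 := by simp [kreinInner]

theorem kreinInner_zero_right (x : E) : kreinInner x 0 = 0 := by simp [kreinInner]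

end Krein

/-! ### Kernels -/

/-- For a family `E = (E x)` of Krein spaces: the `E`-kernels, i.e. maps assigning to each pair
`x, y` a bounded operator `E y → E x`. Sums and differences are pointwise. -/
abbrev HKernel {X : Type u} (E : X → Type v) [∀ x, NormedAddCommGroup (E x)]
    [∀ x, InnerProductSpace ℂ (E x)] : Type (max u v) :=
  ∀ x y : X, E y →L[ℂ] E x

namespace HKernel

variable {X : Type u} {E : X → Type v} [∀ x, NormedAddCommGroup (E x)]
  [∀ x, InnerProductSpace ℂ (E x)]

open Classical in
/-- The convolution operator `(K f)(x) = ∑ y, K(x, y) f(y)`, from the finitely supported vector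
fields to all vector fields. -/
noncomputable def convOp (K : HKernel E) : (Π₀ x, E x) →ₗ[ℂ] (∀ x, E x) :=
  LinearMap.pi fun x => DFinsupp.lsum ℂ fun y => (K x y : E y →ₗ[ℂ] E x)

/-- The kernel has infinite rank: the range of its convolution operator is infinite-dimensional. -/
def HasInfiniteRank (K : HKernel E) : Prop :=
  ¬ FiniteDimensional ℂ (LinearMap.range K.convOp)

variable [∀ x, CompleteSpace (E x)] [∀ x, KreinSpace (E x)]

open Classical in
/-- The inner product `[f, g]_K = ∑ x y, [K(x, y) f(y), g(x)]` on finitely supported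
vector fields. -/
noncomputable def form (K : HKernel E) (f g : Π₀ x, E x) : ℂ :=
  f.sum fun y h => g.sum fun x k => kreinInner (K x y h) k

open scoped ComplexOrder in
/-- `K` is positive semidefinite: `[f, f]_K` is real and nonnegative for all `f`. -/
def IsPosSemidef (K : HKernel E) : Prop :=
  ∀ f : Π₀ x, E x, 0 ≤ K.form f f

open scoped ComplexOrder in
/-- The order of Hermitian kernels: `[f, f]_H ≤ [f, f]_K` for all `f`. -/
def KernelLE (H K : HKernel E) : Prop :=
  ∀ f : Π₀ x, E x, H.form f f ≤ K.form f f

/-- Independence: the only positive semidefinite kernel below both kernels is `0`. -/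
def Independent (H K : HKernel E) : Prop :=
  ∀ P : HKernel E, P.IsPosSemidef → P.KernelLE H → P.KernelLE K → P = 0

/-! ### The Hilbert space of a positive semidefinite kernel -/

theorem form_add_left (K : HKernel E) (f g h : Π₀ x, E x) :
    K.form (f + g) h = K.form f h + K.form g h := by
  classical
  unfold form
  refine DFinsupp.sum_add_index (fun y => ?_) (fun y a b => ?_)
  · simp [DFinsupp.sum, kreinInner_zero_left]
  · simp [DFinsupp.sum, kreinInner_add_left, Finset.sum_add_distrib]

theorem form_add_right (K : HKernel E) (f g h : Π₀ x, E x) :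
    K.form f (g + h) = K.form f g + K.form f h := by
  classical
  unfold form
  simp only [DFinsupp.sum, ← Finset.sum_add_distrib]
  refine Finset.sum_congr rfl fun y _ => ?_
  exact DFinsupp.sum_add_index (h := fun x k => kreinInner (K x y (f y)) k)
    (fun x => kreinInner_zero_right _) (fun x a b => kreinInner_add_right _ _ _)

theorem form_smul_left (K : HKernel E) (c : ℂ) (f g : Π₀ x, E x) :
    K.form (c • f) g = c * K.form f g := by
  classical
  unfold form
  have h := DFinsupp.sum_mapRange_index (f := fun x (a : E x) => c • a)
    (hf := fun x => smul_zero c) (g := f)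
    (h := fun y a => g.sum fun x k => kreinInner (K x y a) k)
    (fun y => by simp [DFinsupp.sum, kreinInner_zero_left])
  have e : DFinsupp.mapRange (fun x (a : E x) => c • a) (fun x => smul_zero c) f = c • f := by
    ext x; simp
  rw [e] at h
  rw [h]
  simp [DFinsupp.sum, kreinInner_smul_left, Finset.mul_sum]

theorem form_smul_right (K : HKernel E) (c : ℂ) (f g : Π₀ x, E x) :
    K.form f (c • g) = (starRingEnd ℂ) c * K.form f g := by
  classical
  unfold form
  simp only [DFinsupp.sum, Finset.mul_sum]
  refine Finset.sum_congr rfl fun y _ => ?_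
  have h := DFinsupp.sum_mapRange_index (f := fun x (a : E x) => c • a)
    (hf := fun x => smul_zero c) (g := g)
    (h := fun x k => kreinInner (K x y (f y)) k)
    (fun x => kreinInner_zero_right _)
  have e : DFinsupp.mapRange (fun x (a : E x) => c • a) (fun x => smul_zero c) g = c • g := by
    ext x; simp
  rw [e] at h
  simp only [DFinsupp.sum] at h
  rw [h]
  simp [kreinInner_smul_right]

theorem IsPosSemidef.form_conj_symm {K : HKernel E} (hK : K.IsPosSemidef) (f g : Π₀ x, E x) :
    (starRingEnd ℂ) (K.form f g) = K.form g f := by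
  have him (f : Π₀ x, E x) : (K.form f f).im = 0 := ((Complex.nonneg_iff.mp (hK f)).2).symm
  have h1 := him (f + g)
  have h2 := him (f + Complex.I • g)
  simp only [form_add_left, form_add_right, form_smul_left, form_smul_right, Complex.add_im,
    Complex.add_re, Complex.mul_im, Complex.mul_re, Complex.conj_I, Complex.neg_re,
    Complex.neg_im, Complex.I_re, Complex.I_im, him f, him g] at h1 h2
  apply Complex.ext
  · rw [Complex.conj_re]; linarith
  · rw [Complex.conj_im]; linarith

/-- The space of finitely supported vector fields, to be equipped with `[·, ·]_K`. -/
def PreSpace (K : HKernel E) (_hK : K.IsPosSemidef) : Type (max u v) := Π₀ x, E x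

variable (K : HKernel E) (hK : K.IsPosSemidef)

noncomputable instance : AddCommGroup (PreSpace K hK) :=
  inferInstanceAs (AddCommGroup (Π₀ x, E x))

noncomputable instance : Module ℂ (PreSpace K hK) :=
  inferInstanceAs (Module ℂ (Π₀ x, E x))

/-- The semi-inner product `inner f g = [g, f]_K` (linear in the second argument `g`). -/
@[reducible]
noncomputable def preCore : PreInnerProductSpace.Core ℂ (PreSpace K hK) where
  inner f g := K.form g f
  conj_inner_symm f g := hK.form_conj_symm f g
  re_inner_nonneg f := (Complex.nonneg_iff.mp (hK f)).1
  add_left f g h := K.form_add_right h f g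
  smul_left f g r := K.form_smul_right r g f

noncomputable instance : SeminormedAddCommGroup (PreSpace K hK) :=
  @InnerProductSpace.Core.toSeminormedAddCommGroup ℂ _ _ _ _ (preCore K hK)

noncomputable instance : InnerProductSpace ℂ (PreSpace K hK) :=
  InnerProductSpace.ofCore (preCore K hK)

/-- The Hilbert space obtained by quotient completion of the finitely supported vector fields with
respect to `[·, ·]_K` (Mathlib's `Completion` of a seminormed space is the Hausdorff one, so it
divides out the isotropic subspace). -/
abbrev Space : Type (max u v) := UniformSpace.Completion (PreSpace K hK)

/-- The class in the Hilbert space `Space K hK` of a finitely supported vector field. -/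
noncomputable def toSpace (f : Π₀ x, E x) : Space K hK :=
  ((show PreSpace K hK from f : PreSpace K hK) : UniformSpace.Completion (PreSpace K hK))

/-- For positive semidefinite `H` and `K`: the kernel `H` is `K`-compact if `H ≤ K` and the
canonical contraction from the Hilbert space of `K` to that of `H`, which sends the class of each
finitely supported vector field to its class, is a compact operator. -/
def IsCompactRelTo {H : HKernel E} (hH : H.IsPosSemidef) {K : HKernel E} (hK : K.IsPosSemidef) :
    Prop :=
  H.KernelLE K ∧ ∃ j : Space K hK →L[ℂ] Space H hH,
    (∀ f : Π₀ x, E x, j (toSpace K hK f) = toSpace H hH f) ∧ IsCompactOperator j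

end HKernel

/-! ### Linearisations -/

/-- A linearisation (Kolmogorov decomposition) of the kernel `H`: a Krein space with bounded
operators `V x` into it such that `H(x, y) = (V x)♯ (V y)`. -/
structure Linearisation {X : Type u} {E : X → Type v} [∀ x, NormedAddCommGroup (E x)]
    [∀ x, InnerProductSpace ℂ (E x)] [∀ x, CompleteSpace (E x)] [∀ x, KreinSpace (E x)]
    (H : HKernel E) where
  /-- The underlying Krein space. -/
  carrier : Type w
  [normed : NormedAddCommGroup carrier]
  [innerProduct : InnerProductSpace ℂ carrier]
  [complete : CompleteSpace carrier]
  [krein : KreinSpace carrier]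
  V : ∀ x, E x →L[ℂ] carrier
  factor : ∀ x y, H x y = kreinAdjoint (V x) ∘L V y

namespace Linearisation

attribute [instance] normed innerProduct complete krein

variable {X : Type u} {E : X → Type v} [∀ x, NormedAddCommGroup (E x)]
  [∀ x, InnerProductSpace ℂ (E x)] [∀ x, CompleteSpace (E x)] [∀ x, KreinSpace (E x)]
  {H : HKernel E}

/-- Minimality: the closed linear span of the ranges of the `V x` is the whole space. -/
def IsMinimal (L : Linearisation.{u, v, w} H) : Prop :=
  (⨆ x, LinearMap.range (L.V x : E x →ₗ[ℂ] L.carrier)).topologicalClosure = ⊤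

/-- Unitary equivalence: there is a bounded operator with bounded inverse between the Krein spaces,
isometric for the indefinite inner products, that carries one family of operators to the other. -/
def UnitarilyEquivalent (L : Linearisation.{u, v, w} H) (M : Linearisation.{u, v, w'} H) : Prop :=
  ∃ U : L.carrier ≃L[ℂ] M.carrier,
    (∀ a b, kreinInner (U a) (U b) = kreinInner a b) ∧
      ∀ x, M.V x = (U : L.carrier →L[ℂ] M.carrier) ∘L L.V x

end Linearisation

/-! ### Spectral theory of compact symmetric operators -/

/-! Let `p` and `q` be the compact canonical contractions from the Hilbert space of `K` to those of
`H₊` and `H₋`. The form of `H₊ - H₋` is given on the Hilbert space of `K` by the compact selfadjoint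
operator `A = p*p - q*q`. A factorisation of `A` through a Krein space by an operator of dense range
yields a minimal linearisation (`Linearisation.ofFactorization`).

Independence and infinite rank force `A` to have infinitely many positive and infinitely many
negative eigenvalues. Otherwise one form would dominate the other on a subspace of finite
codimension, which `HKernel.Independent.exists_lt` excludes by means of a rank one kernel below
both.

Diagonalise `A` and discard its kernel. One factorisation is `|A|^{1/2}` into `ℓ²`, with the signs
of the eigenvalues as fundamental symmetry. For the other, pair positive with negative eigenvalues
and follow `|A|^{1/2}` by a hyperbolic rotation in the plane of each pair. The eigenvalues tend to
zero, so the angles can be unbounded while the product stays bounded. An operator carrying the first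
factorisation to the second would be this unbounded rotation (`exists_inequivalent_factorizations`).
-/

theorem exists_hilbertBasis_of_isCompactOperator {F : Type u} [NormedAddCommGroup F]
    [InnerProductSpace ℂ F] [CompleteSpace F] {A : F →L[ℂ] F} (hA : IsCompactOperator A)
    (hs : (A : F →ₗ[ℂ] F).IsSymmetric) :
    ∃ (ι : Type u) (b : HilbertBasis ι ℂ F) (l : ι → ℝ), ∀ i, A (b i) = (l i : ℂ) • b i := by
  classical
  choose s c hc using fun μ : ℂ =>
    exists_hilbertBasis ℂ (Module.End.eigenspace (A : Module.End ℂ F) μ)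
  let v : (Σ μ : ℂ, s μ) → F := fun a => (c a.1 a.2 : F)
  have hv : Orthonormal ℂ v :=
    hs.orthogonalFamily_eigenspaces.orthonormal_sigma_orthonormal
      (v_family := fun μ => c μ) fun μ => (c μ).orthonormal
  have hspan : (Submodule.span ℂ (Set.range v))ᗮ = ⊥ := by
    rw [eq_bot_iff, ← ContinuousLinearMap.orthogonalComplement_iSup_eigenspaces_eq_bot hA hs]
    intro x hx
    rw [Submodule.mem_orthogonal] at hx ⊢
    -- A vector orthogonal to the chosen bases is orthogonal to every eigenspace, by expanding each
    -- eigenvector in the basis of its eigenspace; the spectral theorem then applies.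
    have key : (⨆ μ, Module.End.eigenspace (A : Module.End ℂ F) μ) ≤
        (ℂ ∙ x)ᗮ := by
      refine iSup_le fun μ y hy => ?_
      have h1 := (c μ).hasSum_repr ⟨y, hy⟩
      have h2 := h1.mapL ((innerSL ℂ x) ∘L
        (Module.End.eigenspace (A : Module.End ℂ F) μ).subtypeL)
      have h3 : inner ℂ x y = 0 := by
        refine h2.unique ?_
        convert hasSum_zero with i
        have := hx (v ⟨μ, i⟩) (Submodule.subset_span ⟨_, rfl⟩)
        rw [inner_eq_zero_symm] at this
        simp
        exact Or.inr this
      exact Submodule.mem_orthogonal_singleton_iff_inner_right.2 h3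
    intro y hy
    exact Submodule.mem_orthogonal_singleton_iff_inner_left.1 (key hy)
  let b := HilbertBasis.mkOfOrthogonalEqBot hv hspan
  have hb : ∀ i, b i = v i := fun i =>
    congrFun (HilbertBasis.coe_mkOfOrthogonalEqBot hv hspan) i
  have he : ∀ i, A (v i) = i.1 • v i := fun i =>
    Module.End.mem_eigenspace_iff.1 (c i.1 i.2).2
  refine ⟨_, b, fun i => i.1.re, fun i => ?_⟩
  have hne : v i ≠ 0 := hv.ne_zero i
  have hreal := hs.conj_eigenvalue_eq_self
    (Module.End.hasEigenvalue_of_hasEigenvector ⟨Module.End.mem_eigenspace_iff.2 (he i), hne⟩)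
  rw [hb, he, Complex.conj_eq_iff_re.1 hreal]

/-- Pairing with `b i` shows that `A (b i)` and `A (b j)` are at distance at least `|l i|` for `i ≠
j`. Infinitely many indices with `|l i| ≥ ε` would thus give a bounded sequence whose images have no
Cauchy subsequence. -/
theorem Orthonormal.finite_setOf_le_abs_eigenvalue {F ι : Type*} [NormedAddCommGroup F]
    [InnerProductSpace ℂ F] {A : F →L[ℂ] F} (hA : IsCompactOperator A) {b : ι → F}
    (hb : Orthonormal ℂ b) {l : ι → ℝ} (h : ∀ i, A (b i) = (l i : ℂ) • b i) {ε : ℝ}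
    (hε : 0 < ε) : {i | ε ≤ |l i|}.Finite := by
  by_contra hinf
  have hinf' : Set.Infinite {i | ε ≤ |l i|} := hinf
  let f := hinf'.natEmbedding
  obtain ⟨K, hK, hsub⟩ := hA.image_closedBall_subset_compact 1
  obtain ⟨a, -, φ, hφ, ht⟩ := hK.tendsto_subseq (x := fun n => A (b (f n))) fun n =>
    hsub ⟨_, by simp [hb.1], rfl⟩
  obtain ⟨N, hN⟩ := Metric.cauchySeq_iff.1 ht.cauchySeq ε hε
  have h1 := hN N le_rfl (N + 1) (Nat.le_succ N)
  have hne : (f (φ N)).1 ≠ (f (φ (N + 1))).1 := fun e => by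
    have := hφ.injective (f.injective (Subtype.ext e)); omega
  have h2 := (f (φ N)).2
  simp only [Function.comp, h, dist_eq_norm] at h1
  set i : ι := (f (φ N)).1
  set j : ι := (f (φ (N + 1))).1
  have h3 : inner ℂ (b i) ((l i : ℂ) • b i - (l j : ℂ) • b j) = (l i : ℂ) := by
    simp [hb.2 hne, hb.1]
  have h4 := norm_inner_le_norm (𝕜 := ℂ) (b i) ((l i : ℂ) • b i - (l j : ℂ) • b j)
  rw [h3, hb.1, one_mul, Complex.norm_real, Real.norm_eq_abs] at h4
  have : ε ≤ |l i| := h2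
  linarith

theorem Orthonormal.abs_eigenvalue_le {F ι : Type*} [NormedAddCommGroup F]
    [InnerProductSpace ℂ F] {A : F →L[ℂ] F} {b : ι → F}
    (hb : Orthonormal ℂ b) {l : ι → ℝ} (h : ∀ i, A (b i) = (l i : ℂ) • b i) (i : ι) :
    |l i| ≤ ‖A‖ := by
  have := A.le_opNorm (b i)
  rwa [h, norm_smul, hb.1, mul_one, mul_one, Complex.norm_real, Real.norm_eq_abs] at this

theorem HilbertBasis.hasSum_inner_apply {F ι : Type*} [NormedAddCommGroup F]
    [InnerProductSpace ℂ F] {A : F →L[ℂ] F}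
    (b : HilbertBasis ι ℂ F) {l : ι → ℝ} (h : ∀ i, A (b i) = (l i : ℂ) • b i) (x y : F) :
    HasSum (fun i => (l i : ℂ) * (inner ℂ x (b i) * inner ℂ (b i) y)) (inner ℂ x (A y)) := by
  have h1 := (b.hasSum_repr y).mapL ((innerSL ℂ x) ∘L A)
  have h2 : (fun i => (l i : ℂ) * (inner ℂ x (b i) * inner ℂ (b i) y)) =
      fun i => ((innerSL ℂ) x ∘L A) (b.repr y i • b i) := by
    ext i
    simp [h, b.repr_apply_apply]
    ring
  rw [h2]
  exact h1

/-! ### Weighted composition operators on sequence spaces -/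

/-- One source for diagonal operators, restriction of coordinates to a subset, and weighted swaps of
coordinates. Injectivity of `σ` ensures that no coordinate is counted twice in the norm. -/
theorem lp.exists_weightedComp {ι κ : Type*} (w : κ → ℝ) {C : ℝ} (hw : ∀ i, |w i| ≤ C)
    {σ : κ → ι} (hσ : Function.Injective σ) :
    ∃ W : lp (fun _ : ι => ℂ) 2 →L[ℂ] lp (fun _ : κ => ℂ) 2,
      ∀ f i, W f i = (w i : ℂ) * f (σ i) := by
  have h2 : (0 : ℝ) < (2 : ENNReal).toReal := by norm_num
  have hle (f : lp (fun _ : ι => ℂ) 2) (i : κ) :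
      ‖(w i : ℂ) * f (σ i)‖ ^ (2 : ℝ) ≤ C ^ 2 * ‖f (σ i)‖ ^ (2 : ℝ) := by
    simp only [Real.rpow_two, norm_mul, mul_pow, Complex.norm_real, Real.norm_eq_abs]
    gcongr
    exact hw i
  have hs (f : lp (fun _ : ι => ℂ) 2) : HasSum (fun i => ‖f i‖ ^ (2 : ℝ)) (‖f‖ ^ (2 : ℝ)) := by
    simpa using lp.hasSum_norm h2 f
  have hs' (f : lp (fun _ : ι => ℂ) 2) : Summable (fun i => C ^ 2 * ‖f (σ i)‖ ^ (2 : ℝ)) :=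
    ((hs f).summable.comp_injective hσ).mul_left _
  have hm (f : lp (fun _ : ι => ℂ) 2) : Memℓp (fun i => (w i : ℂ) * f (σ i)) 2 := by
    refine memℓp_gen ?_
    simp only [ENNReal.toReal_ofNat]
    exact Summable.of_nonneg_of_le (fun i => by positivity) (hle f) (hs' f)
  let L : lp (fun _ : ι => ℂ) 2 →ₗ[ℂ] lp (fun _ : κ => ℂ) 2 :=
    { toFun := fun f => ⟨fun i => (w i : ℂ) * f (σ i), hm f⟩
      map_add' := fun f g => by ext i; exact mul_add _ _ _
      map_smul' := fun c f => by ext i; simp; ring }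
  -- If `κ` is empty, `C` may be negative; hence `|C|`.
  refine ⟨L.mkContinuous |C| fun f => ?_, fun f i => rfl⟩
  have h1 : HasSum (fun i => ‖(w i : ℂ) * f (σ i)‖ ^ (2 : ℝ)) (‖L f‖ ^ (2 : ℝ)) := by
    have := lp.hasSum_norm h2 (L f)
    simp only [ENNReal.toReal_ofNat] at this
    exact this
  have h3 : ‖L f‖ ^ (2 : ℝ) ≤ C ^ 2 * ‖f‖ ^ (2 : ℝ) := by
    calc ‖L f‖ ^ (2 : ℝ) ≤ ∑' i, C ^ 2 * ‖f (σ i)‖ ^ (2 : ℝ) :=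
          h1.tsum_eq ▸ h1.summable.tsum_le_tsum (hle f) (hs' f)
      _ = C ^ 2 * ∑' i, ‖f (σ i)‖ ^ (2 : ℝ) := tsum_mul_left
      _ ≤ C ^ 2 * ‖f‖ ^ (2 : ℝ) := by
          gcongr
          rw [← (hs f).tsum_eq]
          exact tsum_comp_le_tsum_of_inj (hs f).summable (fun i => by positivity) hσ
  simp only [Real.rpow_two] at h3
  refine le_of_sq_le_sq ?_ (by positivity)
  rw [mul_pow, sq_abs]
  exact h3

/-! ### Diagonal Krein spaces and their hyperbolic rotations -/

/-- Swap the terms of a sequence in `P` with those of a sequence in `N` and fix every other index.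
-/
theorem exists_involutive_of_infinite {κ : Type*} {P N : Set κ} (hP : P.Infinite)
    (hN : N.Infinite) (hPN : Disjoint P N) :
    ∃ σ : κ → κ, Function.Involutive σ ∧ {i | σ i ≠ i}.Infinite ∧
      ∀ i, σ i ≠ i → (i ∈ P ∧ σ i ∈ N) ∨ (i ∈ N ∧ σ i ∈ P) := by
  let p := hP.natEmbedding
  let q := hN.natEmbedding
  have hne (m n : ℕ) : (p m).1 ≠ (q n).1 := hPN.ne_of_mem (p m).2 (q n).2
  let e : ℕ ⊕ ℕ ↪ κ :=
    { toFun := Sum.elim (fun n => (p n).1) (fun n => (q n).1)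
      inj' := by
        refine Function.Injective.sumElim (Subtype.val_injective.comp p.injective)
          (Subtype.val_injective.comp q.injective) hne }
  let τ : Equiv.Perm κ := Equiv.Perm.viaEmbedding (Equiv.sumComm ℕ ℕ) e
  have hl (n : ℕ) : τ (p n).1 = (q n).1 :=
    Equiv.Perm.viaEmbedding_apply (Equiv.sumComm ℕ ℕ) e (Sum.inl n)
  have hr (n : ℕ) : τ (q n).1 = (p n).1 :=
    Equiv.Perm.viaEmbedding_apply (Equiv.sumComm ℕ ℕ) e (Sum.inr n)
  have ho (i : κ) (hi : i ∉ Set.range e) : τ i = i :=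
    Equiv.Perm.viaEmbedding_apply_of_notMem _ e i hi
  refine ⟨τ, fun i => ?_, ?_, fun i hi => ?_⟩
  · by_cases hi : i ∈ Set.range e
    · obtain ⟨n | n, rfl⟩ := hi
      · exact (congrArg τ (hl n)).trans (hr n)
      · exact (congrArg τ (hr n)).trans (hl n)
    · rw [ho i hi, ho i hi]
  · refine Set.infinite_of_injective_forall_mem (f := fun n => (p n).1)
      (Subtype.val_injective.comp p.injective) fun n => ?_
    rw [Set.mem_ofPred_eq, hl]
    exact (hne n n).symm
  · by_cases h : i ∈ Set.range e
    · obtain ⟨n | n, rfl⟩ := h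
      · left
        exact ⟨(p n).2, (congrArg (· ∈ N) (hl n)).mpr (q n).2⟩
      · right
        exact ⟨(q n).2, (congrArg (· ∈ P) (hr n)).mpr (p n).2⟩
    · exact absurd (ho i h) hi

theorem exists_diagonal_kreinSpace {κ : Type*} {ε : κ → ℝ} (hε : ∀ i, ε i ^ 2 = 1) :
    ∃ k : KreinSpace (lp (fun _ : κ => ℂ) 2), ∀ f i, k.J f i = (ε i : ℂ) * f i := by
  obtain ⟨J, hJ⟩ := lp.exists_weightedComp ε (C := 1)
    (fun i => (abs_le_of_sq_le_sq' (by simp [hε]) zero_le_one |> abs_le.2))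
    Function.injective_id
  refine ⟨⟨J, ?_, ?_⟩, hJ⟩
  · symm
    rw [ContinuousLinearMap.eq_adjoint_iff]
    intro f g
    rw [lp.inner_eq_tsum, lp.inner_eq_tsum]
    refine tsum_congr fun i => ?_
    simp [hJ]
    ring
  · ext f i
    have : (ε i : ℂ) * ε i = 1 := by
      rw [← pow_two]; exact_mod_cast hε i
    simp [hJ, ← mul_assoc, this]

/-- The data of a hyperbolic rotation, in each plane spanned by the basis vectors with indices
`i` and `σ i`, of the diagonal operator with entries `a i`. -/
structure IsHyperbolicRotation {κ : Type*} (l : κ → ℝ) (σ : κ → κ) (a c s : κ → ℝ) : Prop where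
  invol : Function.Involutive σ
  a_sq : ∀ i, a i ^ 2 = |l i|
  c_comp : ∀ i, c (σ i) = c i
  s_comp : ∀ i, s (σ i) = s i
  sq_sub_sq : ∀ i, c i ^ 2 - s i ^ 2 = 1
  sign_comp : ∀ i, s i ≠ 0 → l (σ i) / |l (σ i)| = - (l i / |l i|)

namespace IsHyperbolicRotation

variable {κ : Type*} {l : κ → ℝ} {σ : κ → κ} {a c s : κ → ℝ}
  {S J : lp (fun _ : κ => ℂ) 2 →L[ℂ] lp (fun _ : κ => ℂ) 2}

theorem hasSum_inner (h : IsHyperbolicRotation l σ a c s) (hl : ∀ i, l i ≠ 0) {C : ℝ}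
    (hC : ∀ i, |l i| ≤ C)
    (hS : ∀ f i, S f i = (a i * c i : ℝ) * f i + (s i * a (σ i) : ℝ) * f (σ i))
    (hJ : ∀ f i, J f i = (l i / |l i| : ℝ) * f i) (f g : lp (fun _ : κ => ℂ) 2) :
    HasSum (fun i => (l i : ℂ) * (starRingEnd ℂ (f i) * g i)) (inner ℂ (S f) (J (S g))) := by
  obtain ⟨D, hD⟩ := lp.exists_weightedComp l hC (σ := id) Function.injective_id
  have h1 := lp.hasSum_inner (𝕜 := ℂ) (S f) (J (S g))
  have h2 := lp.hasSum_inner (𝕜 := ℂ) f (D g)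
  -- The two series differ termwise, but the differences at `i` and `σ i` cancel because the
  -- rotation preserves the indefinite form of each plane. Reindexing by `σ` then shows that the
  -- total difference equals its own negative.
  let t : κ → ℂ := fun i => inner ℂ (S f i) (J (S g) i) - inner ℂ (f i) (D g i)
  have ht : HasSum t (inner ℂ (S f) (J (S g)) - inner ℂ f (D g)) := h1.sub h2
  have ht' : HasSum (t ∘ σ) (inner ℂ (S f) (J (S g)) - inner ℂ f (D g)) :=
    (h.invol.toPerm σ).hasSum_iff.2 ht
  have hanti : ∀ i, t i + t (σ i) = 0 := by
    intro i
    have hli (j : κ) : l j / |l j| * a j ^ 2 = l j := by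
      rw [h.a_sq]; exact div_mul_cancel₀ _ (abs_ne_zero.2 (hl j))
    have e1 := hli i
    have e2 := hli (σ i)
    have e3 := h.sq_sub_sq i
    simp only [t, hS, hJ, hD, id, h.invol i, h.c_comp, h.s_comp, RCLike.inner_apply, map_add,
      map_mul, Complex.conj_ofReal]
    rcases eq_or_ne (s i) 0 with h0 | h0
    · rw [h0] at e3 ⊢
      have e1' : ((l i / |l i| : ℝ) : ℂ) * (a i : ℂ) ^ 2 = l i := by exact_mod_cast e1
      have e2' : ((l (σ i) / |l (σ i)| : ℝ) : ℂ) * (a (σ i) : ℂ) ^ 2 = l (σ i) := by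
        exact_mod_cast e2
      have e3' : (c i : ℂ) ^ 2 = 1 := by
        have : c i ^ 2 = 1 := by linarith
        exact_mod_cast this
      rw [← e1', ← e2']
      push_cast
      linear_combination
        ((l i / |l i| : ℂ) * (a i : ℂ) ^ 2 * starRingEnd ℂ (f i) * g i
          + (l (σ i) / |l (σ i)| : ℂ) * (a (σ i) : ℂ) ^ 2 * starRingEnd ℂ (f (σ i)) * g (σ i)) * e3'
    · rw [h.sign_comp i h0] at e2 ⊢
      generalize l i / |l i| = ε at *
      have e1' : (ε : ℂ) * (a i : ℂ) ^ 2 = l i := by exact_mod_cast e1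
      have e2' : -(ε : ℂ) * (a (σ i) : ℂ) ^ 2 = l (σ i) := by exact_mod_cast e2
      have e3' : (c i : ℂ) ^ 2 - (s i : ℂ) ^ 2 = 1 := by exact_mod_cast e3
      rw [← e1', ← e2']
      push_cast
      linear_combination
        ((ε : ℂ) * (a i : ℂ) ^ 2 * starRingEnd ℂ (f i) * g i
          - (ε : ℂ) * (a (σ i) : ℂ) ^ 2 * starRingEnd ℂ (f (σ i)) * g (σ i)) * e3'
  have h0 : HasSum (fun _ : κ => (0 : ℂ))
      ((inner ℂ (S f) (J (S g)) - inner ℂ f (D g)) +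
        (inner ℂ (S f) (J (S g)) - inner ℂ f (D g))) := by
    simpa [hanti] using ht.add ht'
  have h3 := h0.unique hasSum_zero
  have h4 : inner ℂ (S f) (J (S g)) = inner ℂ f (D g) := by
    linear_combination h3 / 2
  rw [h4]
  have h5 : (fun i => (l i : ℂ) * (starRingEnd ℂ (f i) * g i)) = fun i => inner ℂ (f i) (D g i) := by
    ext i
    simp only [hD, RCLike.inner_apply, id]
    ring
  rw [h5]
  exact h2

theorem apply_single [DecidableEq κ] (h : IsHyperbolicRotation l σ a c s)
    (hS : ∀ f i, S f i = (a i * c i : ℝ) * f i + (s i * a (σ i) : ℝ) * f (σ i)) (i : κ) :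
    S (lp.single 2 i 1) =
      ((a i * c i : ℝ) : ℂ) • lp.single 2 i 1 + ((a i * s i : ℝ) : ℂ) • lp.single 2 (σ i) 1 := by
  ext j
  have h1 : (lp.single 2 i (1 : ℂ) : lp (fun _ : κ => ℂ) 2) (σ j) =
      (lp.single 2 (σ i) (1 : ℂ) : lp (fun _ : κ => ℂ) 2) j := by
    by_cases hj : j = σ i
    · subst hj
      rw [h.invol i]
      simp
    · have hj' : σ j ≠ i := fun e => hj (by rw [← e, h.invol j])
      simp [hj, hj']
  simp only [hS, h1, lp.coeFn_add, lp.coeFn_smul, Pi.add_apply, Pi.smul_apply, smul_eq_mul]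
  congr 1
  · by_cases hj : j = i
    · rw [hj]
    · simp [hj]
  · by_cases hj : j = σ i
    · rw [hj, h.invol i, h.s_comp, mul_comm (s i)]
    · simp [hj]

/-- This gives dense range. After division by `a i`, the conditions at `i` and `σ i` form a linear
system with rows `(c, s)` and `(s, c)`, whose determinant is `c² - s² = 1`. -/
theorem eq_zero_of_inner_single [DecidableEq κ] (h : IsHyperbolicRotation l σ a c s)
    (hl : ∀ i, l i ≠ 0)
    (hS : ∀ f i, S f i = (a i * c i : ℝ) * f i + (s i * a (σ i) : ℝ) * f (σ i))
    {g : lp (fun _ : κ => ℂ) 2} (hg : ∀ i, inner ℂ (S (lp.single 2 i 1)) g = 0) : g = 0 := by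
  have key (i : κ) : (c i : ℂ) * g i + s i * g (σ i) = 0 := by
    have h1 := hg i
    have ha : (a i : ℂ) ≠ 0 := by
      intro h0
      have h2 := h.a_sq i
      rw [Complex.ofReal_eq_zero.1 h0] at h2
      exact abs_ne_zero.2 (hl i) (by simpa using h2.symm)
    rw [h.apply_single hS, inner_add_left, inner_smul_left, inner_smul_left,
      lp.inner_single_left, lp.inner_single_left] at h1
    simp only [Complex.conj_ofReal, RCLike.inner_apply, map_one, mul_one] at h1
    refine (mul_eq_zero.1 ?_).resolve_left ha
    rw [← h1]
    push_cast
    ring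
  ext i
  have h1 := key i
  have h2 := key (σ i)
  rw [h.invol, h.c_comp, h.s_comp] at h2
  have h3 : (c i : ℂ) ^ 2 - (s i : ℂ) ^ 2 = 1 := by exact_mod_cast h.sq_sub_sq i
  simp only [lp.coeFn_zero, Pi.zero_apply]
  linear_combination (c i : ℂ) * h1 - (s i : ℂ) * h2 - g i * h3

end IsHyperbolicRotation

/-! ### Inequivalent factorisations of compact selfadjoint operators -/

/-- Two factorisations of a compact selfadjoint operator through a Krein space which are not
related by a bounded operator. -/
theorem exists_inequivalent_factorizations {F : Type u} [NormedAddCommGroup F]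
    [InnerProductSpace ℂ F] {A : F →L[ℂ] F} (hA : IsCompactOperator A) {ι : Type u}
    (b : HilbertBasis ι ℂ F) {l : ι → ℝ} (hb : ∀ i, A (b i) = (l i : ℂ) • b i)
    (hpos : {i | 0 < l i}.Infinite) (hneg : {i | l i < 0}.Infinite) :
    ∃ (G : Type u) (_ : NormedAddCommGroup G) (_ : InnerProductSpace ℂ G) (_ : CompleteSpace G)
      (_ : KreinSpace G) (T₁ T₂ : F →L[ℂ] G),
      (∀ x y, kreinInner (T₁ y) (T₁ x) = inner ℂ x (A y)) ∧
      (∀ x y, kreinInner (T₂ y) (T₂ x) = inner ℂ x (A y)) ∧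
      DenseRange T₁ ∧ DenseRange T₂ ∧ ∀ U : G →L[ℂ] G, ∃ x, T₂ x ≠ U (T₁ x) := by
  classical
  -- Indices with eigenvalue zero are dropped so that the ranges become dense.
  let κ := {i // l i ≠ 0}
  let m : κ → ℝ := fun i => l i
  have hm : ∀ i, m i ≠ 0 := fun i => i.2
  have hC : ∀ i, |m i| ≤ ‖A‖ := fun i => b.orthonormal.abs_eigenvalue_le hb i
  obtain ⟨σ, hσ, hinf, hsgn⟩ := exists_involutive_of_infinite (κ := κ)
    (P := {i | 0 < m i}) (N := {i | m i < 0})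
    (hpos.preimage fun i (hi : 0 < l i) => ⟨⟨i, hi.ne'⟩, rfl⟩)
    (hneg.preimage fun i (hi : l i < 0) => ⟨⟨i, hi.ne⟩, rfl⟩)
    (Set.disjoint_left.2 fun i (h1 : 0 < m i) (h2 : m i < 0) => lt_asymm h1 h2)
  let a : κ → ℝ := fun i => √|m i|
  -- The larger modulus in a pair governs its angle through `s² = 1 / r` and `c² = 1 + 1 / r`. Then
  -- `a² s² ≤ 1` at both indices of the pair, so the product is bounded, while `c` is unbounded
  -- because `r` becomes arbitrarily small.
  let r : κ → ℝ := fun i => max |m i| |m (σ i)|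
  have hr : ∀ i, 0 < r i := fun i => lt_max_of_lt_left (abs_pos.2 (hm i))
  let c : κ → ℝ := fun i => if σ i = i then 1 else √(1 + 1 / r i)
  let s : κ → ℝ := fun i => if σ i = i then 0 else √(1 / r i)
  have hσ' (i : κ) : σ (σ i) = σ i ↔ σ i = i := hσ.injective.eq_iff
  have hrσ (i : κ) : r (σ i) = r i := by simp only [r, hσ i, max_comm]
  have hsq : ∀ i, c i ^ 2 - s i ^ 2 = 1 := by
    intro i
    by_cases hi : σ i = i
    · simp [c, s, hi]
    · have := hr i
      simp only [c, s, hi, if_false]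
      rw [Real.sq_sqrt (by positivity), Real.sq_sqrt (by positivity)]
      ring
  -- The rotation by angle zero: the plain square root of the moduli.
  have hR₁ : IsHyperbolicRotation m id a (fun _ => 1) (fun _ => 0) :=
    { invol := fun _ => rfl
      a_sq := fun i => Real.sq_sqrt (abs_nonneg _)
      c_comp := fun _ => rfl
      s_comp := fun _ => rfl
      sq_sub_sq := fun _ => by norm_num
      sign_comp := fun _ h => absurd rfl h }
  have hR₂ : IsHyperbolicRotation m σ a c s :=
    { invol := hσ
      a_sq := fun i => Real.sq_sqrt (abs_nonneg _)
      c_comp := fun i => by simp only [c, hσ', hrσ]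
      s_comp := fun i => by simp only [s, hσ', hrσ]
      sq_sub_sq := hsq
      sign_comp := fun i h => by
        have hi : σ i ≠ i := fun e => h (by simp [s, e])
        rcases hsgn i hi with ⟨h1, h2⟩ | ⟨h1, h2⟩
        · have h1' : 0 < m i := h1
          have h2' : m (σ i) < 0 := h2
          rw [abs_of_pos h1', abs_of_neg h2', div_neg, div_self h1'.ne', div_self h2'.ne]
        · have h1' : m i < 0 := h1
          have h2' : 0 < m (σ i) := h2
          rw [abs_of_neg h1', abs_of_pos h2', div_neg, div_self h1'.ne, div_self h2'.ne', neg_neg] }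
  have hε : ∀ i, (m i / |m i|) ^ 2 = 1 := fun i => by
    rw [div_pow, sq_abs, div_self (pow_ne_zero 2 (hm i))]
  obtain ⟨k, hk⟩ := exists_diagonal_kreinSpace hε
  have ha : ∀ i, 0 < a i := fun i => Real.sqrt_pos.2 (abs_pos.2 (hm i))
  have haC : ∀ i, |a i * 1| ≤ √‖A‖ := fun i => by
    rw [mul_one, abs_of_pos (ha i)]
    exact Real.sqrt_le_sqrt (hC i)
  have hac : ∀ i, |a i * c i| ≤ √(‖A‖ + 1) := fun i => by
    refine Real.abs_le_sqrt ?_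
    by_cases hi : σ i = i
    · simp only [c, hi, if_true, mul_one, hR₁.a_sq]
      linarith [hC i]
    · have h1 := hr i
      simp only [c, hi, if_false, mul_pow, hR₁.a_sq]
      rw [Real.sq_sqrt (by positivity), mul_add, mul_one_div, mul_one]
      exact add_le_add (hC i) (div_le_one_of_le₀ (le_max_left _ _) h1.le)
  have hsa : ∀ i, |s i * a (σ i)| ≤ 1 := fun i => by
    refine abs_le_one_iff_mul_self_le_one.2 ?_
    by_cases hi : σ i = i
    · simp [s, hi]
    · have h1 := hr i
      rw [← pow_two]
      simp only [s, hi, if_false, mul_pow, hR₁.a_sq]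
      rw [Real.sq_sqrt (by positivity), one_div_mul_eq_div]
      exact div_le_one_of_le₀ (le_max_right _ _) h1.le
  obtain ⟨S₁, hS₁⟩ := lp.exists_weightedComp _ haC Function.injective_id
  obtain ⟨D, hD⟩ := lp.exists_weightedComp _ hac Function.injective_id
  obtain ⟨D', hD'⟩ := lp.exists_weightedComp _ hsa hσ.injective
  obtain ⟨R, hR⟩ := lp.exists_weightedComp (fun _ : κ => 1) (C := 1) (by simp)
    Subtype.val_injective
  have hS₁' : ∀ f i, S₁ f i = (a i * 1 : ℝ) * f i + (0 * a (id i) : ℝ) * f (id i) :=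
    fun f i => by simp [hS₁]
  have hS₂ : ∀ f i, (D + D') f i = (a i * c i : ℝ) * f i + (s i * a (σ i) : ℝ) * f (σ i) :=
    fun f i => by simp [hD, hD']
  let B : F →L[ℂ] lp (fun _ : κ => ℂ) 2 := R ∘L (b.repr : F →L[ℂ] lp (fun _ : ι => ℂ) 2)
  have hB : ∀ x i, B x i = inner ℂ (b i) x := fun x i => by
    simp [B, hR, b.repr_apply_apply]
  have hBb : ∀ i : κ, B (b i) = lp.single 2 i 1 := fun i => by
    ext j
    by_cases hj : j = i
    · subst hj
      simp [hB, b.orthonormal.1]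
    · have : (j : ι) ≠ i := fun e => hj (Subtype.ext e)
      simp [hB, hj, b.orthonormal.2 this]
  have hinner {τ : κ → κ} {c s : κ → ℝ} {S : lp (fun _ : κ => ℂ) 2 →L[ℂ] lp (fun _ : κ => ℂ) 2}
      (h : IsHyperbolicRotation m τ a c s)
      (hS : ∀ f i, S f i = (a i * c i : ℝ) * f i + (s i * a (τ i) : ℝ) * f (τ i)) (x y : F) :
      kreinInner (S (B y)) (S (B x)) = inner ℂ x (A y) := by
    refine (h.hasSum_inner hm hC hS hk (B x) (B y)).unique ?_
    have h1 := b.hasSum_inner_apply hb x y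
    rw [← (Subtype.val_injective (p := fun i => l i ≠ 0)).hasSum_iff fun i hi => by
      have : l i = 0 := by_contra fun e => hi ⟨⟨i, e⟩, rfl⟩
      simp [this]] at h1
    have h2 : (fun i : κ => (m i : ℂ) * (starRingEnd ℂ (B x i) * B y i)) =
        (fun i => (l i : ℂ) * (inner ℂ x (b i) * inner ℂ (b i) y)) ∘ Subtype.val := by
      ext i
      simp [hB, m]
    rw [h2]
    exact h1
  have hdense {τ : κ → κ} {c s : κ → ℝ} {S : lp (fun _ : κ => ℂ) 2 →L[ℂ] lp (fun _ : κ => ℂ) 2}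
      (h : IsHyperbolicRotation m τ a c s)
      (hS : ∀ f i, S f i = (a i * c i : ℝ) * f i + (s i * a (τ i) : ℝ) * f (τ i)) :
      DenseRange (S ∘L B) := by
    have h1 : (LinearMap.range (S ∘L B : F →ₗ[ℂ] lp (fun _ : κ => ℂ) 2))ᗮ = ⊥ := by
      rw [eq_bot_iff]
      intro g hg
      refine h.eq_zero_of_inner_single hm hS fun i => ?_
      rw [← hBb]
      exact hg _ ⟨b i, rfl⟩
    rw [← Submodule.topologicalClosure_eq_top_iff] at h1
    have := congrArg (fun V : Submodule ℂ _ => (V : Set (lp (fun _ : κ => ℂ) 2))) h1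
    rw [DenseRange, dense_iff_closure_eq]
    exact this
  refine ⟨lp (fun _ : κ => ℂ) 2, inferInstance, inferInstance, inferInstance, k, S₁ ∘L B,
    (D + D') ∘L B, hinner hR₁ hS₁', hinner hR₂ hS₂, hdense hR₁ hS₁', hdense hR₂ hS₂, fun U => ?_⟩
  by_contra! hU
  -- At `b i`, the second factorisation has `i`-th coordinate `a i * c i`, while the first has norm
  -- `a i`.
  have hcU : ∀ i, c i ≤ ‖U‖ := by
    intro i
    have h1 := hU (b i)
    simp only [ContinuousLinearMap.comp_apply, hBb] at h1
    have h2 : S₁ (lp.single 2 i 1) = (a i : ℂ) • lp.single 2 i 1 := by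
      simpa using hR₁.apply_single hS₁' i
    have h3 : a i * c i ≤ ‖(D + D') (lp.single 2 i 1)‖ := by
      have h5 : ((D + D') (lp.single 2 i 1)) i = (a i * c i : ℝ) := by
        by_cases hi : σ i = i
        · have hs : s i = 0 := by simp [s, hi]
          rw [hS₂, hs]
          simp
        · rw [hS₂]
          simp [hi]
      have h6 := lp.norm_apply_le_norm two_ne_zero ((D + D') (lp.single 2 i 1)) i
      rw [h5, Complex.norm_real] at h6
      exact (le_abs_self _).trans h6
    have h4 : ‖U (S₁ (lp.single 2 i 1))‖ ≤ ‖U‖ * a i := by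
      refine (U.le_opNorm _).trans_eq ?_
      rw [h2, norm_smul, lp.norm_single (by norm_num), norm_one, mul_one, Complex.norm_real,
        Real.norm_of_nonneg (ha i).le]
    rw [← h1] at h4
    have := h3.trans h4
    rw [mul_comm] at this
    exact le_of_mul_le_mul_right this (ha i)
  -- From `1 + 1 / r i ≤ ‖U‖²` it follows that `r i` is at least this constant, so each moved index
  -- or its partner carries an eigenvalue of at least this modulus. Compactness leaves finitely many
  -- such indices.
  have hδ : 0 < 1 / (‖U‖ ^ 2 + 1) := by positivity
  have hfin : {i : κ | 1 / (‖U‖ ^ 2 + 1) ≤ |m i|}.Finite :=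
    (b.orthonormal.comp _ Subtype.val_injective).finite_setOf_le_abs_eigenvalue hA
      (fun i => hb i) hδ
  refine hinf ((hfin.union (hfin.preimage hσ.injective.injOn)).subset fun i hi => ?_)
  have hi' : σ i ≠ i := hi
  have h1 := hcU i
  simp only [c, hi', if_false] at h1
  have h2 := hr i
  rw [Real.sqrt_le_left (norm_nonneg _)] at h1
  have h3 : 1 / (‖U‖ ^ 2 + 1) ≤ r i := by
    rw [one_div_le (by positivity) h2]
    linarith
  exact le_max_iff.1 h3

/-- If `p*p - q*q` had finitely many positive eigenvalues, take `M` to be the span of the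
corresponding basis vectors: on `Mᗮ` the operator is nonpositive, against `hqp`. The negative
eigenvalues are treated likewise with `hpq`. -/
theorem exists_inequivalent_factorizations_sub {F : Type u} {F₁ F₂ : Type*}
    [NormedAddCommGroup F] [InnerProductSpace ℂ F] [CompleteSpace F]
    [NormedAddCommGroup F₁] [InnerProductSpace ℂ F₁] [CompleteSpace F₁]
    [NormedAddCommGroup F₂] [InnerProductSpace ℂ F₂] [CompleteSpace F₂]
    {p : F →L[ℂ] F₁} {q : F →L[ℂ] F₂} (hp : IsCompactOperator p) (hq : IsCompactOperator q)
    (hqp : ∀ (M : Submodule ℂ F) [FiniteDimensional ℂ M], ∃ x ∈ Mᗮ, ‖q x‖ < ‖p x‖)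
    (hpq : ∀ (M : Submodule ℂ F) [FiniteDimensional ℂ M], ∃ x ∈ Mᗮ, ‖p x‖ < ‖q x‖) :
    ∃ (G : Type u) (_ : NormedAddCommGroup G) (_ : InnerProductSpace ℂ G) (_ : CompleteSpace G)
      (_ : KreinSpace G) (T₁ T₂ : F →L[ℂ] G),
      (∀ x y, kreinInner (T₁ y) (T₁ x) = inner ℂ (p x) (p y) - inner ℂ (q x) (q y)) ∧
      (∀ x y, kreinInner (T₂ y) (T₂ x) = inner ℂ (p x) (p y) - inner ℂ (q x) (q y)) ∧
      DenseRange T₁ ∧ DenseRange T₂ ∧ ∀ U : G →L[ℂ] G, ∃ x, T₂ x ≠ U (T₁ x) := by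
  let A : F →L[ℂ] F :=
    ContinuousLinearMap.adjoint p ∘L p - ContinuousLinearMap.adjoint q ∘L q
  have hA (x y : F) : inner ℂ x (A y) = inner ℂ (p x) (p y) - inner ℂ (q x) (q y) := by
    simp only [A, sub_apply, ContinuousLinearMap.comp_apply, inner_sub_right,
      ContinuousLinearMap.adjoint_inner_right]
  have hAc : IsCompactOperator A :=
    (hp.clm_comp (ContinuousLinearMap.adjoint p)).sub (hq.clm_comp (ContinuousLinearMap.adjoint q))
  have hAs : (A : F →ₗ[ℂ] F).IsSymmetric := fun x y => by
    change inner ℂ (A x) y = inner ℂ x (A y)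
    rw [← inner_conj_symm, hA, hA, map_sub, inner_conj_symm, inner_conj_symm]
  obtain ⟨ι, b, l, hb⟩ := exists_hilbertBasis_of_isCompactOperator hAc hAs
  have hAx (x : F) :
      HasSum (fun i => l i * ‖inner ℂ (b i) x‖ ^ 2) (‖p x‖ ^ 2 - ‖q x‖ ^ 2) := by
    have h1 := b.hasSum_inner_apply hb x x
    rw [hA, inner_self_eq_norm_sq_to_K, inner_self_eq_norm_sq_to_K] at h1
    rw [← Complex.hasSum_ofReal]
    have h2 : (fun i => ((l i * ‖inner ℂ (b i) x‖ ^ 2 : ℝ) : ℂ)) =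
        fun i => (l i : ℂ) * (inner ℂ x (b i) * inner ℂ (b i) x) := by
      ext i
      rw [← inner_conj_symm x (b i), Complex.conj_mul']
      push_cast
      rfl
    rw [h2]
    push_cast
    exact h1
  have hpos : {i | 0 < l i}.Infinite := by
    intro hfin
    have : FiniteDimensional ℂ (Submodule.span ℂ (b '' {i | 0 < l i})) :=
      FiniteDimensional.span_of_finite ℂ (hfin.image b)
    obtain ⟨x, hx, hlt⟩ := hqp (Submodule.span ℂ (b '' {i | 0 < l i}))
    have h1 : ‖p x‖ ^ 2 - ‖q x‖ ^ 2 ≤ 0 := (hAx x).nonpos fun i => by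
      by_cases hi : 0 < l i
      · rw [Submodule.inner_right_of_mem_orthogonal
          (Submodule.subset_span (Set.mem_image_of_mem b hi)) hx]
        simp
      · exact mul_nonpos_of_nonpos_of_nonneg (not_lt.1 hi) (by positivity)
    nlinarith [norm_nonneg (p x), norm_nonneg (q x)]
  have hneg : {i | l i < 0}.Infinite := by
    intro hfin
    have : FiniteDimensional ℂ (Submodule.span ℂ (b '' {i | l i < 0})) :=
      FiniteDimensional.span_of_finite ℂ (hfin.image b)
    obtain ⟨x, hx, hlt⟩ := hpq (Submodule.span ℂ (b '' {i | l i < 0}))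
    have h1 : 0 ≤ ‖p x‖ ^ 2 - ‖q x‖ ^ 2 := (hAx x).nonneg fun i => by
      by_cases hi : l i < 0
      · rw [Submodule.inner_right_of_mem_orthogonal
          (Submodule.subset_span (Set.mem_image_of_mem b hi)) hx]
        simp
      · exact mul_nonneg (not_lt.1 hi) (by positivity)
    nlinarith [norm_nonneg (p x), norm_nonneg (q x)]
  simp only [← hA]
  exact exists_inequivalent_factorizations hAc b hb hpos hneg

/-! ### The Kolmogorov decomposition of a positive semidefinite kernel -/

theorem KreinSpace.J_J {E : Type*} [NormedAddCommGroup E] [InnerProductSpace ℂ E]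
    [CompleteSpace E] [KreinSpace E] (x : E) : KreinSpace.J (KreinSpace.J x) = x :=
  congrArg (fun S : E →L[ℂ] E => S x) KreinSpace.J_comp_J

theorem eq_zero_of_kreinInner_eq_zero {E : Type*} [NormedAddCommGroup E] [InnerProductSpace ℂ E]
    [CompleteSpace E] [KreinSpace E] {x : E} (h : ∀ y, kreinInner x y = 0) : x = 0 := by
  have h1 : KreinSpace.J x = 0 := inner_self_eq_zero.1 (h (KreinSpace.J x))
  rw [← KreinSpace.J_J x, h1, map_zero]

theorem eq_of_kreinInner_eq {E : Type*} [NormedAddCommGroup E] [InnerProductSpace ℂ E]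
    [CompleteSpace E] [KreinSpace E] {x z : E} (h : ∀ y, kreinInner x y = kreinInner z y) :
    x = z := by
  refine sub_eq_zero.1 (eq_zero_of_kreinInner_eq_zero fun y => ?_)
  have := h y
  simp only [kreinInner] at this
  simp [kreinInner, this]

theorem kreinInner_conj_symm {E : Type*} [NormedAddCommGroup E] [InnerProductSpace ℂ E]
    [CompleteSpace E] [KreinSpace E] (x y : E) :
    starRingEnd ℂ (kreinInner x y) = kreinInner y x := by
  rw [kreinInner, inner_conj_symm, inner_J_left, kreinInner]

namespace HKernel

variable {X : Type u} {E : X → Type v} [∀ x, NormedAddCommGroup (E x)]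
  [∀ x, InnerProductSpace ℂ (E x)] [∀ x, CompleteSpace (E x)] [∀ x, KreinSpace (E x)]

open Classical in
theorem form_single_right (K : HKernel E) (f : Π₀ x, E x) (x : X) (k : E x) :
    K.form f (DFinsupp.single x k) = kreinInner (K.convOp f x) k := by
  have h1 : K.form f (DFinsupp.single x k) = f.sum fun y h => kreinInner (K x y h) k := by
    unfold form
    refine Finset.sum_congr rfl fun y _ => ?_
    exact DFinsupp.sum_single_index (h := fun x k => kreinInner (K x y (f y)) k)
      (kreinInner_zero_right _)
  have h2 : K.convOp f x = f.sum fun y h => K x y h := by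
    simp only [convOp, LinearMap.pi_apply, DFinsupp.lsum_apply_apply, DFinsupp.sumAddHom_apply]
    rfl
  rw [h1, h2]
  simp only [kreinInner, DFinsupp.sum, map_sum, inner_sum]

open Classical in
theorem form_single_single (K : HKernel E) {x y : X} (h : E y) (k : E x) :
    K.form (DFinsupp.single y h) (DFinsupp.single x k) = kreinInner (K x y h) k := by
  rw [form_single_right]
  congr 1
  simp only [convOp, LinearMap.pi_apply, DFinsupp.lsum_apply_apply]
  exact DFinsupp.sumAddHom_single _ _ _

theorem convOp_eq_zero_of_form_eq_zero {K : HKernel E} {f : Π₀ x, E x} :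
    (∀ g, K.form f g = 0) → K.convOp f = 0 := by
  classical
  intro h
  ext x
  refine eq_zero_of_kreinInner_eq_zero fun k => ?_
  rw [← form_single_right, h]

theorem sub_form (H K : HKernel E) (f g : Π₀ x, E x) :
    (H - K).form f g = H.form f g - K.form f g := by
  simp [form, DFinsupp.sum, kreinInner, Finset.sum_sub_distrib]

theorem inner_toSpace (K : HKernel E) (hK : K.IsPosSemidef) (f g : Π₀ x, E x) :
    inner ℂ (K.toSpace hK f) (K.toSpace hK g) = K.form g f :=
  UniformSpace.Completion.inner_coe (𝕜 := ℂ) (E := PreSpace K hK) f g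

/-- The canonical linear map from finitely supported vector fields to the Hilbert space of a
positive semidefinite kernel. -/
noncomputable def toSpaceₗ (K : HKernel E) (hK : K.IsPosSemidef) :
    (Π₀ x, E x) →ₗ[ℂ] Space K hK :=
  (UniformSpace.Completion.toComplL (𝕜 := ℂ) (E := PreSpace K hK) :
    PreSpace K hK →ₗ[ℂ] Space K hK)

theorem toSpaceₗ_apply (K : HKernel E) (hK : K.IsPosSemidef) (f : Π₀ x, E x) :
    K.toSpaceₗ hK f = K.toSpace hK f := rfl

theorem denseRange_toSpace (K : HKernel E) (hK : K.IsPosSemidef) : DenseRange (K.toSpace hK) :=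
  UniformSpace.Completion.denseRange_coe (α := PreSpace K hK)

theorem norm_toSpace_sq (K : HKernel E) (hK : K.IsPosSemidef) (f : Π₀ x, E x) :
    ((‖K.toSpace hK f‖ ^ 2 : ℝ) : ℂ) = K.form f f := by
  rw [← inner_toSpace K hK, inner_self_eq_norm_sq_to_K]
  simp

open Classical in
/-- The bounded operators of the Kolmogorov decomposition of a positive semidefinite kernel. -/
noncomputable def embed (K : HKernel E) (hK : K.IsPosSemidef) (x : X) : E x →L[ℂ] Space K hK :=
  LinearMap.mkContinuous ((K.toSpaceₗ hK) ∘ₗ (DFinsupp.lsingle (R := ℂ) x))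
    -- The squared norm of the image of `h` is `[K(x, x) h, h] = ⟨J K(x, x) h, h⟩`.
    (√(‖(KreinSpace.J : E x →L[ℂ] E x) ∘L K x x‖)) fun h => by
      simp only [LinearMap.comp_apply, toSpaceₗ_apply, DFinsupp.lsingle_apply]
      refine le_of_sq_le_sq ?_ (by positivity)
      rw [mul_pow, Real.sq_sqrt (norm_nonneg _)]
      have h1 := norm_toSpace_sq K hK (DFinsupp.single x h)
      rw [form_single_single, kreinInner] at h1
      have h2 := congrArg norm h1
      rw [Complex.norm_real, Real.norm_of_nonneg (by positivity)] at h2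
      rw [h2, pow_two, ← mul_assoc, mul_comm]
      refine (norm_inner_le_norm _ _).trans ?_
      gcongr
      exact ((KreinSpace.J : E x →L[ℂ] E x) ∘L K x x).le_opNorm h

open Classical in
theorem embed_apply (K : HKernel E) (hK : K.IsPosSemidef) (x : X) (h : E x) :
    K.embed hK x h = K.toSpace hK (DFinsupp.single x h) := by
  simp only [embed, LinearMap.mkContinuous_apply, LinearMap.comp_apply, toSpaceₗ_apply,
    DFinsupp.lsingle_apply]

open Classical in
theorem toSpace_eq_sum (K : HKernel E) (hK : K.IsPosSemidef) (f : Π₀ x, E x) :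
    K.toSpace hK f = f.sum fun x h => K.embed hK x h := by
  conv_lhs => rw [← DFinsupp.sum_single (f := f)]
  rw [← toSpaceₗ_apply, DFinsupp.sum, map_sum]
  exact Finset.sum_congr rfl fun x _ => (embed_apply K hK x (f x)).symm

/-- The kernel below a multiple of `K` that is defined by a bounded operator on the Hilbert space
of `K`. -/
noncomputable def ofOperator (K : HKernel E) (hK : K.IsPosSemidef)
    (T : Space K hK →L[ℂ] Space K hK) : HKernel E := fun x y =>
  (KreinSpace.J : E x →L[ℂ] E x) ∘L ContinuousLinearMap.adjoint (K.embed hK x) ∘L T ∘L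
    K.embed hK y

theorem form_ofOperator (K : HKernel E) (hK : K.IsPosSemidef)
    (T : Space K hK →L[ℂ] Space K hK) (f g : Π₀ x, E x) :
    (K.ofOperator hK T).form f g = inner ℂ (K.toSpace hK g) (T (K.toSpace hK f)) := by
  classical
  rw [toSpace_eq_sum K hK f, toSpace_eq_sum K hK g]
  simp only [form, DFinsupp.sum, map_sum, inner_sum, sum_inner]
  refine Finset.sum_congr rfl fun y _ => Finset.sum_congr rfl fun x _ => ?_
  simp only [kreinInner, ofOperator, ContinuousLinearMap.comp_apply, KreinSpace.J_J,
    ContinuousLinearMap.adjoint_inner_right]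

/-- The convolution operator kills every field of zero class, so its range is a quotient of the
space of classes. -/
theorem not_finiteDimensional_space (K : HKernel E) (hK : K.IsPosSemidef) (h : K.HasInfiniteRank) :
    ¬ FiniteDimensional ℂ (Space K hK) := by
  intro hfin
  refine h ?_
  have hker : LinearMap.ker (K.toSpaceₗ hK) ≤ LinearMap.ker K.convOp := by
    intro f hf
    rw [LinearMap.mem_ker, toSpaceₗ_apply] at hf
    refine convOp_eq_zero_of_form_eq_zero fun g => ?_
    rw [← inner_toSpace K hK, hf, inner_zero_right]
  have h1 : FiniteDimensional ℂ ((Π₀ x, E x) ⧸ LinearMap.ker (K.toSpaceₗ hK)) :=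
    Module.Finite.equiv (K.toSpaceₗ hK).quotKerEquivRange.symm
  let q := (LinearMap.ker (K.toSpaceₗ hK)).liftQ K.convOp hker
  have h2 : LinearMap.range q = LinearMap.range K.convOp := Submodule.range_liftQ _ _ _
  rw [← h2]
  exact Module.Finite.range q

/-! ### Independence and domination on subspaces of finite codimension -/

theorem Independent.symm {H K : HKernel E} (h : Independent H K) : Independent K H :=
  fun P hP h1 h2 => h P hP h2 h1

/-- The rank one kernel with form `t * |⟨a, f⟩|²` lies below both `H` and `K` for small `t > 0`, so
it vanishes; density of the classes then gives `a = 0`. -/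
theorem Independent.eq_zero_of_le {H K : HKernel E} (h : Independent H K) (hH : H.IsPosSemidef)
    (hK : K.IsPosSemidef) {a : Space H hH} {C : ℝ}
    (hC : ∀ f, ‖inner ℂ a (H.toSpace hH f)‖ ≤ C * ‖K.toSpace hK f‖) : a = 0 := by
  let t : ℝ := 1 / (1 + ‖a‖ ^ 2 + C ^ 2)
  have ht : 0 < t := by positivity
  have ht1 : t * ‖a‖ ^ 2 ≤ 1 := by
    rw [one_div_mul_eq_div]
    exact div_le_one_of_le₀ (by nlinarith [sq_nonneg C]) (by positivity)
  have ht2 : t * C ^ 2 ≤ 1 := by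
    rw [one_div_mul_eq_div]
    exact div_le_one_of_le₀ (by nlinarith [sq_nonneg ‖a‖]) (by positivity)
  let T : Space H hH →L[ℂ] Space H hH := (t : ℂ) • (innerSL ℂ a).smulRight a
  have hT (f : Π₀ x, E x) : (H.ofOperator hH T).form f f =
      ((t * ‖inner ℂ a (H.toSpace hH f)‖ ^ 2 : ℝ) : ℂ) := by
    rw [form_ofOperator]
    simp only [T, smul_apply, ContinuousLinearMap.smulRight_apply,
      innerSL_apply_apply, inner_smul_right]
    rw [← inner_conj_symm (H.toSpace hH f) a, Complex.mul_conj']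
    push_cast
    rfl
  have h0 : H.ofOperator hH T = 0 := by
    refine h _ (fun f => ?_) (fun f => ?_) (fun f => ?_)
    · rw [hT]
      exact Complex.zero_le_real.2 (by positivity)
    · rw [hT, ← norm_toSpace_sq H hH]
      refine Complex.real_le_real.2 ?_
      calc t * ‖inner ℂ a (H.toSpace hH f)‖ ^ 2 ≤ t * (‖a‖ * ‖H.toSpace hH f‖) ^ 2 := by
            gcongr
            exact norm_inner_le_norm _ _
        _ = (t * ‖a‖ ^ 2) * ‖H.toSpace hH f‖ ^ 2 := by ring
        _ ≤ 1 * ‖H.toSpace hH f‖ ^ 2 := by gcongr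
        _ = _ := one_mul _
    · rw [hT, ← norm_toSpace_sq K hK]
      refine Complex.real_le_real.2 ?_
      calc t * ‖inner ℂ a (H.toSpace hH f)‖ ^ 2 ≤ t * (C * ‖K.toSpace hK f‖) ^ 2 := by
            gcongr
            exact hC f
        _ = (t * C ^ 2) * ‖K.toSpace hK f‖ ^ 2 := by ring
        _ ≤ 1 * ‖K.toSpace hK f‖ ^ 2 := by gcongr
        _ = _ := one_mul _
  have h1 (f : Π₀ x, E x) : inner ℂ a (H.toSpace hH f) = 0 := by
    have h2 := hT f
    rw [h0] at h2
    have h3 : (0 : HKernel E).form f f = 0 := by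
      simp [form, DFinsupp.sum, kreinInner]
    rw [h3, eq_comm, Complex.ofReal_eq_zero] at h2
    simpa [ht.ne'] using h2
  refine (inner_self_eq_zero (𝕜 := ℂ)).1 ?_
  exact (denseRange_toSpace H hH).induction_on (p := fun y => inner ℂ a y = 0) a
    (isClosed_eq (by fun_prop) continuous_const) h1

/-- If `H` and `K` are independent and the Hilbert space of `H` is infinite-dimensional, then the
form of `H` is not dominated by that of `K` on a subspace of finite codimension. -/
theorem Independent.exists_lt {H K : HKernel E} (h : Independent H K) (hH : H.IsPosSemidef)
    (hK : K.IsPosSemidef) (hinf : ¬ FiniteDimensional ℂ (Space H hH)) {F : Type*}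
    [NormedAddCommGroup F] [InnerProductSpace ℂ F] [CompleteSpace F]
    {jH : F →L[ℂ] Space H hH} {jK : F →L[ℂ] Space K hK} {e : (Π₀ x, E x) → F}
    (hjH : ∀ f, jH (e f) = H.toSpace hH f) (hjK : ∀ f, jK (e f) = K.toSpace hK f)
    (M : Submodule ℂ F) [FiniteDimensional ℂ M] : ∃ x ∈ Mᗮ, ‖jK x‖ < ‖jH x‖ := by
  by_contra! hN
  -- Domination on `Mᗮ` makes `jK x ↦ jH x` a well defined contraction there. Extending it to the
  -- closure, and by zero on the orthogonal complement, gives `C` with `C ∘ jK = jH` on `Mᗮ`.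
  let jN : Mᗮ →ₗ[ℂ] Space K hK := (jK : F →ₗ[ℂ] Space K hK) ∘ₗ Mᗮ.subtype
  let Y : Submodule ℂ (Space K hK) := (LinearMap.range jN).topologicalClosure
  have hYc : CompleteSpace Y := (Submodule.isClosed_topologicalClosure _).completeSpace_coe
  have hmem (x : Mᗮ) : jN x ∈ Y := Submodule.le_topologicalClosure _ ⟨x, rfl⟩
  let eN : Mᗮ →ₗ[ℂ] Y := jN.codRestrict Y hmem
  have hdense : DenseRange eN := by
    intro y
    rw [closure_subtype]
    have h1 : Subtype.val '' Set.range eN = (LinearMap.range jN : Set (Space K hK)) := by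
      rw [← Set.range_comp]
      rfl
    rw [h1]
    exact y.2
  let f₀ : Mᗮ →ₗ[ℂ] Space H hH := (jH : F →ₗ[ℂ] Space H hH) ∘ₗ Mᗮ.subtype
  have hC₀ (x : Mᗮ) : f₀.extendOfNorm eN (eN x) = f₀ x :=
    LinearMap.extendOfNorm_eq hdense ⟨1, fun x => by
      rw [one_mul]
      exact hN x x.2⟩ x
  let C : Space K hK →L[ℂ] Space H hH := f₀.extendOfNorm eN ∘L Y.orthogonalProjectionOnto
  have hC (x : F) (hx : x ∈ Mᗮ) : C (jK x) = jH x := by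
    have h1 : Y.orthogonalProjectionOnto (jK x) = eN ⟨x, hx⟩ :=
      Submodule.orthogonalProjectionOnto_mem_subspace_eq_self (eN ⟨x, hx⟩)
    simp only [C, ContinuousLinearMap.comp_apply, h1, hC₀]
    rfl
  -- `R` vanishes on `Mᗮ`, so its range is the finite-dimensional space `R(M)`. A nonzero `a`
  -- orthogonal to it satisfies `⟨a, jH x⟩ = ⟨a, C (jK x)⟩`, a functional bounded by the norm of
  -- `K`.
  let R : F →L[ℂ] Space H hH := jH - C ∘L jK
  let W : Submodule ℂ (Space H hH) := M.map (R : F →ₗ[ℂ] Space H hH)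
  have hR (x : F) : R x ∈ W := by
    refine ⟨M.starProjection x, Submodule.starProjection_apply_mem _ _, ?_⟩
    have h1 : R (x - M.starProjection x) = 0 := by
      have := hC _ (M.sub_starProjection_mem_orthogonal x)
      simp only [R, sub_apply, ContinuousLinearMap.comp_apply, this, sub_self]
    rw [map_sub, sub_eq_zero] at h1
    exact h1.symm
  have hW : Wᗮ ≠ ⊥ := fun h1 => by
    rw [Submodule.orthogonal_eq_bot_iff] at h1
    have h2 : FiniteDimensional ℂ (⊤ : Submodule ℂ (Space H hH)) := by
      rw [← h1]; infer_instance
    exact hinf (Module.finite_def.2 (Module.Finite.iff_fg.1 h2))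
  obtain ⟨a, haW, ha⟩ := Submodule.exists_mem_ne_zero_of_ne_bot hW
  refine ha (h.eq_zero_of_le hH hK (C := ‖a‖ * ‖C‖) fun f => ?_)
  have h1 : inner ℂ a (R (e f)) = 0 := Submodule.inner_left_of_mem_orthogonal (hR _) haW
  simp only [R, sub_apply, ContinuousLinearMap.comp_apply, hjH, hjK,
    inner_sub_right, sub_eq_zero] at h1
  rw [h1, mul_assoc]
  refine (norm_inner_le_norm _ _).trans ?_
  gcongr
  exact C.le_opNorm _

end HKernel

/-! ### From factorisations of the form to linearisations -/

namespace Linearisation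

variable {X : Type u} {E : X → Type v} [∀ x, NormedAddCommGroup (E x)]
  [∀ x, InnerProductSpace ℂ (E x)] [∀ x, CompleteSpace (E x)] [∀ x, KreinSpace (E x)]

/-- The linearisation obtained from a factorisation of the form of a kernel `H` through the Hilbert
space of a positive semidefinite kernel `K`. -/
@[reducible]
noncomputable def ofFactorization {H K : HKernel E} (hK : K.IsPosSemidef)
    {G : Type w} [NormedAddCommGroup G] [InnerProductSpace ℂ G] [CompleteSpace G] [KreinSpace G]
    (T : HKernel.Space K hK →L[ℂ] G)
    (hT : ∀ f g, kreinInner (T (K.toSpace hK f)) (T (K.toSpace hK g)) = H.form f g) :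
    Linearisation.{u, v, w} H where
  carrier := G
  V x := T ∘L K.embed hK x
  factor x y := by
    classical
    ext h
    refine eq_of_kreinInner_eq fun k => ?_
    -- Conjugation puts the adjoint into the second argument, where its defining property applies.
    rw [ContinuousLinearMap.comp_apply,
      ← kreinInner_conj_symm k (kreinAdjoint _ _), ← kreinInner_kreinAdjoint,
      kreinInner_conj_symm, ContinuousLinearMap.comp_apply, ContinuousLinearMap.comp_apply,
      HKernel.embed_apply, HKernel.embed_apply, hT, HKernel.form_single_single]

theorem isMinimal_ofFactorization {H K : HKernel E} (hK : K.IsPosSemidef)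
    {G : Type w} [NormedAddCommGroup G] [InnerProductSpace ℂ G] [CompleteSpace G] [KreinSpace G]
    {T : HKernel.Space K hK →L[ℂ] G}
    (hT : ∀ f g, kreinInner (T (K.toSpace hK f)) (T (K.toSpace hK g)) = H.form f g)
    (hd : DenseRange T) : (ofFactorization hK T hT).IsMinimal := by
  classical
  have h1 : DenseRange (T ∘ K.toSpace hK) :=
    hd.comp (HKernel.denseRange_toSpace K hK) T.continuous
  rw [IsMinimal, ← Submodule.dense_iff_topologicalClosure_eq_top]
  refine h1.mono ?_
  rintro _ ⟨f, rfl⟩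
  rw [Function.comp, HKernel.toSpace_eq_sum, DFinsupp.sum, map_sum]
  exact Submodule.sum_mem _ fun x _ =>
    Submodule.mem_iSup_of_mem x ⟨f x, rfl⟩

end Linearisation

/-! ### Non-uniqueness of the minimal linearisation -/

theorem corollary8p2 {X : Type u} {E : X → Type v} [∀ x, NormedAddCommGroup (E x)]
    [∀ x, InnerProductSpace ℂ (E x)] [∀ x, CompleteSpace (E x)] [∀ x, KreinSpace (E x)]
    (Hp Hm K : HKernel E)
    (hHp : Hp.IsPosSemidef) (hHm : Hm.IsPosSemidef) (hK : K.IsPosSemidef)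
    (hind : HKernel.Independent Hp Hm)
    (hrankp : Hp.HasInfiniteRank) (hrankm : Hm.HasInfiniteRank)
    (hcompp : HKernel.IsCompactRelTo hHp hK) (hcompm : HKernel.IsCompactRelTo hHm hK) :
    ∃ L M : Linearisation.{u, v, max u v} (Hp - Hm),
      L.IsMinimal ∧ M.IsMinimal ∧ ¬ L.UnitarilyEquivalent M := by
  obtain ⟨-, p, hp, hpc⟩ := hcompp
  obtain ⟨-, q, hq, hqc⟩ := hcompm
  obtain ⟨G, _, _, _, _, T₁, T₂, hT₁, hT₂, hd₁, hd₂, hne⟩ :=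
    exists_inequivalent_factorizations_sub hpc hqc
      (fun M _ => hind.exists_lt hHp hHm (Hp.not_finiteDimensional_space hHp hrankp) hp hq M)
      (fun M _ => hind.symm.exists_lt hHm hHp (Hm.not_finiteDimensional_space hHm hrankm) hq hp M)
  have hform {T : HKernel.Space K hK →L[ℂ] G}
      (hT : ∀ x y, kreinInner (T y) (T x) = inner ℂ (p x) (p y) - inner ℂ (q x) (q y))
      (f g : Π₀ x, E x) :
      kreinInner (T (K.toSpace hK f)) (T (K.toSpace hK g)) = (Hp - Hm).form f g := by
    rw [hT, hp, hp, hq, hq, HKernel.inner_toSpace, HKernel.inner_toSpace, HKernel.sub_form]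
  refine ⟨.ofFactorization hK T₁ (hform hT₁), .ofFactorization hK T₂ (hform hT₂),
    Linearisation.isMinimal_ofFactorization hK _ hd₁,
    Linearisation.isMinimal_ofFactorization hK _ hd₂, ?_⟩
  rintro ⟨U, -, hU⟩
  obtain ⟨x, hx⟩ := hne (U : G →L[ℂ] G)
  -- The relation on the generators extends by linearity to classes of vector fields and by density
  -- to the whole space, so `U` would carry `T₁` to `T₂`.
  refine hx ((HKernel.denseRange_toSpace K hK).induction_on
    (p := fun x => T₂ x = (U : G →L[ℂ] G) (T₁ x)) x
    (isClosed_eq (by fun_prop) (by fun_prop)) fun f => ?_)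
  classical
  simp only [HKernel.toSpace_eq_sum, DFinsupp.sum, map_sum]
  exact Finset.sum_congr rfl fun x _ => congrArg (fun S : E x →L[ℂ] G => S (f x)) (hU x)
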